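/- Let $\mathbb{K}$ be a field of characteristic $0$ with algebraic closure $\overline{\mathbb{K}}$. For a commutative ring $R$, let $R^{\mathrm{fr}}((t))$ denote the ring of fractional Laurent series (Puiseux series) $\sum_{n\ge n_0} a_n t^{n/d}$ with $a_n\in R$, $n_0\in\mathbb{Z}$ and $d\in\mathbb{N}\setminus\{0\}$ (both depending on the series), and let $R^{\mathrm{fr}}[[t]]$ be the subring of the series in which no negative exponent occurs (fractional power series). A series $U\in R^{\mathrm{fr}}((t))$ is *finite at $t=0$* if no negative exponent occurs in it, and *vanishes at $t=0$* if only positive exponents occur in it (in particular $U=0$ vanishes at $t=0$). There are natural inclusions $\mathbb{K}^{\mathrm{fr}}[[t]][u]\subset \mathbb{K}[u]^{\mathrm{fr}}[[t]]\subset\mathbb{K}[[u]]^{\mathrm{fr}}[[t]]$. Let $\Delta(t,u)\in\mathbb{K}^{\mathrm{fr}}[[t]][u]$ be a non-zero polynomial in $u$ with coefficients in $\mathbb{K}^{\mathrm{fr}}[[t]]$. Then: 1. The roots of $\Delta(t,\cdot)$ belong to $\overline{\mathbb{K}}^{\mathrm{fr}}((t))$; that is, $\Delta$ splits into factors of degree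 at most $1$ in $u$ over the field $\overline{\mathbb{K}}^{\mathrm{fr}}((t))$. 2. If $\Delta$ has a square root in $\mathbb{K}[[u]]^{\mathrm{fr}}[[t]]$ (that is, $\Delta=\delta^2$ for some $\delta\in\mathbb{K}[[u]]^{\mathrm{fr}}[[t]]$), then every root $U\in\overline{\mathbb{K}}^{\mathrm{fr}}((t))$ of $\Delta$ that vanishes at $t=0$ has even multiplicity in $\Delta$. 3. If $\Delta$ has a square root in $\mathbb{K}[u]^{\mathrm{fr}}[[t]]$, then every root $U\in\overline{\mathbb{K}}^{\mathrm{fr}}((t))$ of $\Delta$ that is finite at $t=0$ has even multiplicity in $\Delta$. -/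

import Mathlib

namespace FractionalSeries

/-- A formal sum `∑ a_q t^q` with rational exponents has a common denominator: there is `d ≥ 1`
such that every exponent that occurs is of the form `n / d` with `n` an integer. Since the support
of a Hahn series is well-ordered, such a series is of the form `∑_{n ≥ n₀} a_n t^(n/d)`. -/
def HasCommonDenominator {R : Type*} [CommRing R] (x : HahnSeries ℚ R) : Prop :=
  ∃ d : ℕ, 0 < d ∧ ∀ q : ℚ, x.coeff q ≠ 0 → ∃ n : ℤ, q = (n : ℚ) / (d : ℚ)

section Closure

variable {R : Type*} [CommRing R]

theorem HasCommonDenominator.single_zero (a : R) :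
    HasCommonDenominator (HahnSeries.C a : HahnSeries ℚ R) := by
  refine ⟨1, one_pos, fun q hq => ⟨0, ?_⟩⟩
  by_contra h
  refine hq ?_
  rw [HahnSeries.C_apply]
  exact HahnSeries.coeff_single_of_ne (by simpa using h)

theorem HasCommonDenominator.add {x y : HahnSeries ℚ R} (hx : HasCommonDenominator x)
    (hy : HasCommonDenominator y) : HasCommonDenominator (x + y) := by
  obtain ⟨d, hd, hx⟩ := hx
  obtain ⟨e, he, hy⟩ := hy
  have hd' : (d : ℚ) ≠ 0 := by exact_mod_cast hd.ne'
  have he' : (e : ℚ) ≠ 0 := by exact_mod_cast he.ne'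
  refine ⟨d * e, Nat.mul_pos hd he, fun q hq => ?_⟩
  by_cases h : x.coeff q = 0
  · obtain ⟨n, rfl⟩ := hy q (fun h' => hq (by simp [h, h']))
    exact ⟨n * d, by push_cast; field_simp⟩
  · obtain ⟨n, rfl⟩ := hx q h
    exact ⟨n * e, by push_cast; field_simp⟩

theorem HasCommonDenominator.neg {x : HahnSeries ℚ R} (hx : HasCommonDenominator x) :
    HasCommonDenominator (-x) := by
  obtain ⟨d, hd, hx⟩ := hx
  exact ⟨d, hd, fun q hq => hx q (fun h => hq (by simp [h]))⟩

theorem exists_of_coeff_mul_ne_zero {x y : HahnSeries ℚ R} {q : ℚ} (hq : (x * y).coeff q ≠ 0) :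
    ∃ a b : ℚ, x.coeff a ≠ 0 ∧ y.coeff b ≠ 0 ∧ a + b = q := by
  obtain ⟨a, ha, b, hb, h⟩ := Set.mem_add.1 (HahnSeries.support_mul_subset
    ((HahnSeries.mem_support _ _).2 hq))
  exact ⟨a, b, ha, hb, h⟩

theorem HasCommonDenominator.mul {x y : HahnSeries ℚ R} (hx : HasCommonDenominator x)
    (hy : HasCommonDenominator y) : HasCommonDenominator (x * y) := by
  obtain ⟨d, hd, hx⟩ := hx
  obtain ⟨e, he, hy⟩ := hy
  have hd' : (d : ℚ) ≠ 0 := by exact_mod_cast hd.ne'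
  have he' : (e : ℚ) ≠ 0 := by exact_mod_cast he.ne'
  refine ⟨d * e, Nat.mul_pos hd he, fun q hq => ?_⟩
  obtain ⟨a, b, ha, hb, rfl⟩ := exists_of_coeff_mul_ne_zero hq
  obtain ⟨n, rfl⟩ := hx a ha
  obtain ⟨m, rfl⟩ := hy b hb
  exact ⟨n * e + m * d, by push_cast; field_simp⟩

end Closure

/-- The ring `R^fr((t))` of fractional Laurent series (Puiseux series) in `t` over `R`. -/
def FracLaurent (R : Type*) [CommRing R] : Subring (HahnSeries ℚ R) where
  carrier := {x | HasCommonDenominator x}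
  mul_mem' := HasCommonDenominator.mul
  one_mem' := by simpa using HasCommonDenominator.single_zero (1 : R)
  add_mem' := HasCommonDenominator.add
  zero_mem' := by simpa using HasCommonDenominator.single_zero (0 : R)
  neg_mem' := HasCommonDenominator.neg

/-- The ring `R^fr[[t]]` of fractional power series in `t` over `R`: the fractional Laurent series
that have no negative exponent. -/
def FracPower (R : Type*) [CommRing R] : Subring (HahnSeries ℚ R) where
  carrier := {x | HasCommonDenominator x ∧ ∀ q : ℚ, q < 0 → x.coeff q = 0}
  mul_mem' := by
    rintro x y ⟨hx, hx0⟩ ⟨hy, hy0⟩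
    refine ⟨hx.mul hy, fun q hq => ?_⟩
    by_contra h
    obtain ⟨a, b, ha, hb, rfl⟩ := exists_of_coeff_mul_ne_zero h
    have h1 : 0 ≤ a := le_of_not_gt fun h => ha (hx0 a h)
    have h2 : 0 ≤ b := le_of_not_gt fun h => hb (hy0 b h)
    linarith
  one_mem' := by
    refine ⟨by simpa using HasCommonDenominator.single_zero (1 : R), fun q hq => ?_⟩
    simp [HahnSeries.coeff_one, hq.ne]
  add_mem' := by
    rintro x y ⟨hx, hx0⟩ ⟨hy, hy0⟩
    exact ⟨hx.add hy, fun q hq => by simp [hx0 q hq, hy0 q hq]⟩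
  zero_mem' := ⟨by simpa using HasCommonDenominator.single_zero (0 : R), fun q _ => by simp⟩
  neg_mem' := by
    rintro x ⟨hx, hx0⟩
    exact ⟨hx.neg, fun q hq => by simp [hx0 q hq]⟩

theorem fracPower_le_fracLaurent (R : Type*) [CommRing R] : FracPower R ≤ FracLaurent R :=
  fun _ hx => hx.1

/-- The inverse (in the field of Hahn series) of a Puiseux series over a field is a Puiseux
series. -/
theorem inv_mem_fracLaurent {K : Type*} [Field K] {x : HahnSeries ℚ K} (hx : x ∈ FracLaurent K) :
    x⁻¹ ∈ FracLaurent K := by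
  obtain ⟨d, hd, hx⟩ := hx
  have hd' : (0 : ℚ) < d := by exact_mod_cast hd
  let f : ℤ →+ ℚ :=
    { toFun := fun n => (n : ℚ) / (d : ℚ)
      map_zero' := by simp
      map_add' := fun a b => by push_cast; ring }
  have hle : ∀ g g' : ℤ, f g ≤ f g' ↔ g ≤ g' := fun g g' => by
    change (g : ℚ) / (d : ℚ) ≤ (g' : ℚ) / (d : ℚ) ↔ g ≤ g'
    rw [div_le_div_iff_of_pos_right hd', Int.cast_le]
  have hinj : Function.Injective f := fun a b h =>
    le_antisymm ((hle a b).1 h.le) ((hle b a).1 h.ge)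
  let y : HahnSeries ℤ K :=
    { coeff := fun n => x.coeff (f n)
      isPWO_support' := by
        refine Set.IsWF.isPWO ?_
        rw [Set.isWF_iff_no_descending_seq]
        intro s hs hmem
        have hw := Set.isWF_iff_no_descending_seq.1 x.isPWO_support.isWF (fun n => f (s n))
          (fun a b hab => lt_of_not_ge fun h => (hs hab).not_ge ((hle _ _).1 h))
        exact hw fun n => hmem n }
  have hxy : HahnSeries.embDomainRingHom f hinj hle y = x := by
    ext q
    by_cases hq : x.coeff q = 0
    · rw [hq]
      by_cases hr : q ∈ Set.range f
      · obtain ⟨n, rfl⟩ := hr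
        exact (HahnSeries.embDomain_coeff (f := ⟨⟨f, hinj⟩, hle _ _⟩)).trans hq
      · exact HahnSeries.embDomain_of_notMem_range (f := ⟨⟨f, hinj⟩, hle _ _⟩) hr
    · obtain ⟨n, rfl⟩ := hx q hq
      exact HahnSeries.embDomain_coeff (f := ⟨⟨f, hinj⟩, hle _ _⟩)
  refine ⟨d, hd, fun q hq => ?_⟩
  rw [← hxy, ← map_inv₀] at hq
  by_contra hn
  refine hq (HahnSeries.embDomain_of_notMem_range (f := ⟨⟨f, hinj⟩, hle _ _⟩) ?_)
  rintro ⟨n, rfl⟩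
  exact hn ⟨n, rfl⟩

/-- Puiseux series over a field form a field. -/
noncomputable instance instFieldFracLaurent (K : Type*) [Field K] : Field (FracLaurent K) where
  inv x := ⟨(x : HahnSeries ℚ K)⁻¹, inv_mem_fracLaurent x.2⟩
  exists_pair_ne := ⟨0, 1, fun h => zero_ne_one (congrArg Subtype.val h)⟩
  mul_inv_cancel x hx := Subtype.ext (mul_inv_cancel₀ fun h => hx (Subtype.ext h))
  inv_zero := Subtype.ext inv_zero
  nnqsmul := _
  nnqsmul_def := fun _ _ => rfl
  qsmul := _
  qsmul_def := fun _ _ => rfl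

/-- Applying a ring homomorphism to each coefficient of a fractional power series:
`∑ a_q t^q ↦ ∑ f(a_q) t^q`. -/
noncomputable def FracPower.map {R S : Type*} [CommRing R] [CommRing S] (f : R →+* S) :
    FracPower R →+* FracPower S where
  toFun x := ⟨(x : HahnSeries ℚ R).map f, by
    obtain ⟨x, ⟨d, hd, hx⟩, hx0⟩ := x
    refine ⟨⟨d, hd, fun q hq => hx q fun h => hq ?_⟩, fun q hq => ?_⟩
    · simp [h]
    · simp [hx0 q hq]⟩
  map_one' := Subtype.ext (by ext q; by_cases h : q = 0 <;> simp [HahnSeries.coeff_one, h])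
  map_mul' x y := Subtype.ext (HahnSeries.map_mul (f : R →ₙ+* S))
  map_zero' := Subtype.ext (by ext q; simp)
  map_add' x y := Subtype.ext (by ext q; simp)

/-- The constant series (in `t`) with value `a`. -/
noncomputable def FracPower.const {R : Type*} [CommRing R] (a : R) : FracPower R :=
  ⟨HahnSeries.C a, HasCommonDenominator.single_zero a, fun q hq => by
    rw [HahnSeries.C_apply]
    exact HahnSeries.coeff_single_of_ne hq.ne⟩

/-- The inclusion of `K^fr[[t]]` into `L^fr((t))` for a field extension `L` of `K`. -/
noncomputable def toFracLaurent (K L : Type*) [Field K] [Field L] [Algebra K L] :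
    FracPower K →+* FracLaurent L :=
  (Subring.inclusion (fracPower_le_fracLaurent L)).comp (FracPower.map (algebraMap K L))

/-- The inclusion `R^fr[[t]][u] ⊂ R[u]^fr[[t]]`. -/
noncomputable def toPolySeries (R : Type*) [CommRing R] :
    Polynomial (FracPower R) →+* FracPower (Polynomial R) :=
  Polynomial.eval₂RingHom (FracPower.map Polynomial.C) (FracPower.const Polynomial.X)

/-- The inclusion `R^fr[[t]][u] ⊂ R[[u]]^fr[[t]]`. -/
noncomputable def toPowerSeriesSeries (R : Type*) [CommRing R] :
    Polynomial (FracPower R) →+* FracPower (PowerSeries R) :=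
  (FracPower.map Polynomial.coeToPowerSeries.ringHom).comp (toPolySeries R)

/-- The coefficient of `t^q u^n` is the same in `R^fr[[t]][u]` and in `R[u]^fr[[t]]`. -/
theorem coeff_toPolySeries {R : Type*} [CommRing R] (p : Polynomial (FracPower R)) (q : ℚ)
    (n : ℕ) :
    ((toPolySeries R p : HahnSeries ℚ (Polynomial R)).coeff q).coeff n =
      (p.coeff n : HahnSeries ℚ R).coeff q := by
  induction p using Polynomial.induction_on' with
  | add p r hp hr => simp [hp, hr]
  | monomial m a =>
    have h : (toPolySeries R (Polynomial.monomial m a) : HahnSeries ℚ (Polynomial R)) =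
        (a : HahnSeries ℚ R).map (Polynomial.C : R →+* Polynomial R) *
          HahnSeries.single 0 (Polynomial.X ^ m) := by
      simp [toPolySeries, FracPower.const, FracPower.map]
    rw [h, HahnSeries.coeff_mul_single_zero, HahnSeries.map_coeff, Polynomial.coeff_C_mul,
      Polynomial.coeff_X_pow, Polynomial.coeff_monomial]
    by_cases hmn : n = m
    · simp [hmn]
    · simp [hmn, Ne.symm hmn]

/-- The coefficient of `t^q u^n` is the same in `R^fr[[t]][u]` and in `R[[u]]^fr[[t]]`. -/
theorem coeff_toPowerSeriesSeries {R : Type*} [CommRing R] (p : Polynomial (FracPower R)) (q : ℚ)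
    (n : ℕ) :
    PowerSeries.coeff n ((toPowerSeriesSeries R p : HahnSeries ℚ (PowerSeries R)).coeff q) =
      (p.coeff n : HahnSeries ℚ R).coeff q := by
  rw [← coeff_toPolySeries]
  exact Polynomial.coeff_coe _ _

/-- `U` is finite at `t = 0`: no negative exponent of `t` occurs in `U`. -/
def FiniteAtZero {R : Type*} [CommRing R] (U : FracLaurent R) : Prop :=
  ∀ q : ℚ, q < 0 → (U : HahnSeries ℚ R).coeff q = 0

/-- `U` vanishes at `t = 0`: only positive exponents of `t` occur in `U`. -/
def VanishesAtZero {R : Type*} [CommRing R] (U : FracLaurent R) : Prop :=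
  ∀ q : ℚ, q ≤ 0 → (U : HahnSeries ℚ R).coeff q = 0

end FractionalSeries

open FractionalSeries

/-! Both halves of the theorem rest on Weierstrass preparation over `L⟦s⟧`, where `L` is a field and
`s = t^(1/d)` for a common denominator `d` of the series involved.

Splitting is the Newton–Puiseux theorem for `L` algebraically closed of characteristic zero.
Translate the unknown to kill the second coefficient of a monic polynomial, then rescale it by the
extremal Newton slope. Unless the polynomial is `X ^ n`, it becomes integral and its reduction at `s
= 0` is not a power of a linear polynomial. Preparation at a root of the reduction gives a factor of
intermediate degree (`exists_monic_factor`), and induction on the degree gives a root.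

For parity, suppose `P = δ²` with `δ` a power series in `s` and `u`. Preparation writes `δ = s^k W
e`, with `W` distinguished in `u` and `e` a unit, so `P = s^(2k) W² e²`. A unit does not vanish at a
root `U` with `U(0) = 0`, so the multiplicity of `U` in `P` is twice that in `W`
(`even_rootMultiplicity`). If `δ` has coefficients polynomial in `u`, the substitution `u ↦ u +
U(0)` is allowed and reduces finite roots to vanishing ones. -/

theorem Polynomial.coeff_taylor_natDegree_sub_one {R : Type*} [CommRing R] {P : Polynomial R}
    (hP : P.Monic) {n : ℕ} (hn : P.natDegree = n) (hpos : 0 < n) (c : R) :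
    (taylor c P).coeff (n - 1) = P.coeff (n - 1) + n * c := by
  -- The Taylor coefficient is the value at `c` of a Hasse derivative, here linear with leading
  -- coefficient `n.choose (n - 1) = n`.
  have hd : (hasseDeriv (n - 1) P).natDegree < 2 :=
    (natDegree_hasseDeriv_le P (n - 1)).trans_lt (by omega)
  have h1 : 1 + (n - 1) = n := by omega
  have h2 : n.choose (n - 1) = n := (Nat.choose_symm hpos).trans (Nat.choose_one_right n)
  rw [taylor_coeff, eval_eq_sum_range' hd, Finset.sum_range_succ, Finset.sum_range_one,
    hasseDeriv_coeff, hasseDeriv_coeff, h1, h2, ← hn, hP.coeff_natDegree]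
  simp

/-! ### Weierstrass preparation and its consequences over `L⟦X⟧` -/

namespace PowerSeries

open Polynomial

section Weierstrass

variable {L : Type*} [Field L]

instance isAdicComplete_maximalIdeal : IsAdicComplete (IsLocalRing.maximalIdeal L⟦X⟧) L⟦X⟧ := by
  rw [maximalIdeal_eq_span_X]
  infer_instance

theorem mem_maximalIdeal_iff {x : L⟦X⟧} :
    x ∈ IsLocalRing.maximalIdeal L⟦X⟧ ↔ constantCoeff x = 0 := by
  rw [maximalIdeal_eq_span_X, Ideal.mem_span_singleton, X_dvd_iff]

/-- Weierstrass preparation over `L⟦X⟧`. -/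
theorem exists_distinguished_mul_unit {f : L⟦X⟧⟦X⟧} (hf : f.map constantCoeff ≠ 0) :
    ∃ (g : L⟦X⟧[X]) (h : L⟦X⟧⟦X⟧), g.IsDistinguishedAt (IsLocalRing.maximalIdeal L⟦X⟧) ∧
      IsUnit h ∧ f = g * h := by
  have hf' : f.map (IsLocalRing.residue L⟦X⟧) ≠ 0 := by
    contrapose! hf
    ext n
    have := congrArg (coeff n) hf
    rw [coeff_map, map_zero, IsLocalRing.residue_eq_zero_iff, mem_maximalIdeal_iff] at this
    simpa using this
  obtain ⟨g, h, H⟩ := exists_isWeierstrassFactorization hf'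
  exact ⟨g, h, H.1, H.2, H.3⟩

theorem map_constantCoeff_of_isDistinguishedAt {g : L⟦X⟧[X]}
    (hg : g.IsDistinguishedAt (IsLocalRing.maximalIdeal L⟦X⟧)) :
    g.map constantCoeff = Polynomial.X ^ g.natDegree := by
  ext n
  rw [Polynomial.coeff_map, Polynomial.coeff_X_pow]
  rcases lt_trichotomy n g.natDegree with h | rfl | h
  · rw [if_neg h.ne, mem_maximalIdeal_iff.1 (hg.mem h)]
  · simp [hg.monic.leadingCoeff]
  · rw [if_neg h.ne', Polynomial.coeff_eq_zero_of_natDegree_lt h, map_zero]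

/-- A polynomial divisible by a distinguished polynomial as a power series is divisible by it as a
polynomial, with the same quotient. -/
theorem exists_polynomial_quotient {g f : L⟦X⟧[X]} {q : L⟦X⟧⟦X⟧}
    (hg : g.IsDistinguishedAt (IsLocalRing.maximalIdeal L⟦X⟧)) (h : (f : L⟦X⟧⟦X⟧) = g * q) :
    ∃ q' : L⟦X⟧[X], f = g * q' ∧ (q' : L⟦X⟧⟦X⟧) = q := by
  have hne : IsLocalRing.maximalIdeal L⟦X⟧ ≠ ⊤ := Ideal.IsPrime.ne_top'
  have hord := hg.coe_natDegree_eq_order_map g 1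
    (by rwa [constantCoeff_one, ← Ideal.ne_top_iff_one]) (by simp)
  have heq : (g : L⟦X⟧⟦X⟧) * (q - (f /ₘ g : L⟦X⟧[X])) = (f %ₘ g : L⟦X⟧[X]) := by
    have := congrArg (fun p : L⟦X⟧[X] => (p : L⟦X⟧⟦X⟧)) (Polynomial.modByMonic_add_div f g)
    simp only [Polynomial.coe_add, Polynomial.coe_mul] at this
    rw [mul_sub, ← h, ← this]
    ring
  -- Uniqueness of Weierstrass division: a multiple of `g` that is a polynomial of smaller degree is
  -- zero, and so is its cofactor.
  obtain ⟨h1, h2⟩ := (hg.isWeierstrassDivisorAt hne).eq_zero_of_mul_eq (by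
    rw [← hord]
    exact (Polynomial.degree_modByMonic_lt f hg.monic).trans_eq
      (Polynomial.degree_eq_natDegree hg.monic.ne_zero)) heq
  refine ⟨f /ₘ g, ?_, (sub_eq_zero.1 h1).symm⟩
  conv_lhs => rw [← Polynomial.modByMonic_add_div f g, h2, zero_add]

/-- A monic polynomial over `L⟦X⟧` whose reduction has the root `0` and is not a power of `X` has a
monic factor of intermediate degree. -/
theorem exists_monic_factor_of_root_zero {P : L⟦X⟧[X]} (hP : P.Monic)
    (h0 : constantCoeff (P.coeff 0) = 0)
    (hX : P.map constantCoeff ≠ Polynomial.X ^ P.natDegree) :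
    ∃ G : L⟦X⟧[X], G.Monic ∧ 0 < G.natDegree ∧ G.natDegree < P.natDegree ∧ G ∣ P := by
  have hP' : (P : L⟦X⟧⟦X⟧).map constantCoeff ≠ 0 := by
    intro h
    have := congrArg (coeff P.natDegree) h
    simp [hP.leadingCoeff] at this
  obtain ⟨g, h, hg, hu, hPg⟩ := exists_distinguished_mul_unit hP'
  obtain ⟨q, hPq, rfl⟩ := exists_polynomial_quotient hg hPg
  have hq : q.Monic := hg.monic.of_mul_monic_left (hPq ▸ hP)
  -- If `g` had degree `0`, then `P` would be a unit series, against `h0`; if it had full degree,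
  -- then `P = g` would reduce to a power of `X`.
  refine ⟨g, hg.monic, Nat.pos_of_ne_zero fun hd => ?_, ?_, q, hPq⟩
  · have hg1 : g = 1 := hg.monic.natDegree_eq_zero.1 hd
    rw [hg1, one_mul] at hPq
    have := (isUnit_iff_constantCoeff.1 (isUnit_iff_constantCoeff.1 hu)).ne_zero
    rw [← coeff_zero_eq_constantCoeff_apply (φ := (q : L⟦X⟧⟦X⟧)), Polynomial.coeff_coe,
      ← hPq] at this
    exact this h0
  · have hdeg : P.natDegree = g.natDegree + q.natDegree := by
      rw [hPq, hg.monic.natDegree_mul hq]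
    refine lt_of_le_of_ne (by omega) fun hd => hX ?_
    have hq1 : q = 1 := hq.natDegree_eq_zero.1 (by omega)
    rw [hPq, hq1, mul_one]
    exact map_constantCoeff_of_isDistinguishedAt hg

/-- A monic polynomial over `L⟦X⟧` whose reduction has a root `a` and is not a power of `X - a`
has a monic factor of intermediate degree. -/
theorem exists_monic_factor {P : L⟦X⟧[X]} (hP : P.Monic) {a : L}
    (h0 : (P.map constantCoeff).IsRoot a)
    (hX : P.map constantCoeff ≠ (Polynomial.X - Polynomial.C a) ^ P.natDegree) :
    ∃ G : L⟦X⟧[X], G.Monic ∧ 0 < G.natDegree ∧ G.natDegree < P.natDegree ∧ G ∣ P := by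
  have hmap : (Polynomial.taylor (C a) P).map constantCoeff =
      Polynomial.taylor a (P.map constantCoeff) := by
    simp [Polynomial.taylor_apply, Polynomial.map_comp]
  obtain ⟨G, hG, h1, h2, h3⟩ := exists_monic_factor_of_root_zero
    (P := Polynomial.taylor (C a) P) ((Polynomial.leadingCoeff_taylor _ _).trans hP) (by
      rw [← Polynomial.coeff_map, hmap, Polynomial.taylor_coeff_zero]
      exact h0) (fun h => by
      rw [hmap, Polynomial.natDegree_taylor] at h
      refine hX (Polynomial.taylor_injective a ?_)
      rw [h]
      simp [Polynomial.taylor_apply])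
  rw [Polynomial.natDegree_taylor] at h2
  refine ⟨Polynomial.taylor (-C a) G, (Polynomial.leadingCoeff_taylor _ _).trans hG,
    by simpa using h1, by simpa using h2, ?_⟩
  have := map_dvd (Polynomial.taylorAlgHom (-C a : L⟦X⟧)) h3
  simpa [Polynomial.taylor_taylor] using this

/-- Preparation needs a non-zero reduction. Take for `k` the least exponent of the inner variable
that occurs in any coefficient of `f`. -/
theorem exists_eq_C_X_pow_mul {f : L⟦X⟧⟦X⟧} (hf : f ≠ 0) :
    ∃ (k : ℕ) (g : L⟦X⟧⟦X⟧), g.map constantCoeff ≠ 0 ∧ f = C (X ^ k) * g := by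
  classical
  obtain ⟨n, hn⟩ : ∃ n, coeff n f ≠ 0 := by
    by_contra! h
    exact hf (ext fun n => by simpa using h n)
  have hex : ∃ k m, coeff k (coeff m f) ≠ 0 := by
    by_contra! h
    exact hn (ext fun k => by simpa using h k n)
  obtain ⟨m, hm⟩ := Nat.find_spec hex
  have hmin : ∀ m, X ^ Nat.find hex ∣ coeff m f := fun m =>
    X_pow_dvd_iff.2 fun j hj => by
      have := Nat.find_min hex hj
      push Not at this
      exact this m
  choose g hg using hmin
  refine ⟨Nat.find hex, mk g, fun h => hm ?_, ext fun m => by rw [coeff_C_mul, coeff_mk, ← hg]⟩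
  have := congrArg (coeff m) h
  rw [hg m, coeff_X_pow_mul', if_pos le_rfl, Nat.sub_self]
  simpa using this

/-- A polynomial over `L⟦X⟧` that is a square of a power series has even multiplicity at each root
without constant term. -/
theorem even_rootMultiplicity {P : L⟦X⟧[X]} (hP : P ≠ 0) {δ : L⟦X⟧⟦X⟧}
    (hδ : δ ^ 2 = (P : L⟦X⟧⟦X⟧)) {U : L⟦X⟧} (hU : constantCoeff U = 0) :
    Even (P.rootMultiplicity U) := by
  have hδ0 : δ ≠ 0 := by
    rintro rfl
    exact hP (by simpa using hδ.symm)
  obtain ⟨k, g, hg, rfl⟩ := exists_eq_C_X_pow_mul hδ0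
  obtain ⟨W, e, hW, he, rfl⟩ := exists_distinguished_mul_unit hg
  -- `W * W` is again distinguished, so the cofactor `X^(2k) e²` of `P` is a polynomial; removing
  -- `X^(2k)` leaves a polynomial `r` equal to the unit `e²`.
  obtain ⟨q, hq, hqe⟩ := exists_polynomial_quotient (f := P) (g := W * W)
    (q := C (X ^ k * X ^ k) * e ^ 2) (hW.mul hW) (by
      rw [← hδ, Polynomial.coe_mul, map_mul]
      ring)
  obtain ⟨r, rfl⟩ := (Polynomial.C_dvd_iff_dvd_coeff (X ^ k * X ^ k) q).2 fun i => by
    rw [← Polynomial.coeff_coe, hqe, coeff_C_mul]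
    exact dvd_mul_right _ _
  have hXk : (X ^ k * X ^ k : L⟦X⟧) ≠ 0 := mul_ne_zero (pow_ne_zero _ X_ne_zero)
    (pow_ne_zero _ X_ne_zero)
  have hr : (r : L⟦X⟧⟦X⟧) = e ^ 2 := by
    rw [Polynomial.coe_mul, Polynomial.coe_C] at hqe
    exact mul_left_cancel₀ (fun h => hXk (C_injective (by simpa using h))) hqe
  have hr0 : constantCoeff (r.coeff 0) ≠ 0 := by
    have := (isUnit_iff_constantCoeff.1 (isUnit_iff_constantCoeff.1 (he.pow 2))).ne_zero
    rwa [← hr, ← coeff_zero_eq_constantCoeff_apply (φ := (r : L⟦X⟧⟦X⟧)),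
      Polynomial.coeff_coe] at this
  -- As `U` reduces to `0`, the constant term of `r.eval U` is that of `r.coeff 0`.
  have hrU : r.eval U ≠ 0 := by
    intro h
    have h' := congrArg constantCoeff h
    rw [map_zero, ← Polynomial.eval_map_apply, hU, ← Polynomial.coeff_zero_eq_eval_zero,
      Polynomial.coeff_map] at h'
    exact hr0 h'
  rw [hq] at hP ⊢
  rw [Polynomial.rootMultiplicity_mul hP, Polynomial.rootMultiplicity_mul (left_ne_zero_of_mul hP),
    Polynomial.rootMultiplicity_mul (right_ne_zero_of_mul hP), Polynomial.rootMultiplicity_C,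
    Polynomial.rootMultiplicity_eq_zero hrU, add_zero, add_zero]
  exact ⟨_, rfl⟩

end Weierstrass

end PowerSeries

/-! ### Ramification: fractional power series as power series in `t^(1/d)` -/

namespace FractionalSeries

open Polynomial PowerSeries

section Ramify

variable {R : Type*} [CommRing R]

/-- The homomorphism `n ↦ n / d`. -/
def divNatHom (d : ℕ) : ℕ →+ ℚ where
  toFun n := (n : ℚ) / d
  map_zero' := by simp
  map_add' a b := by push_cast; ring

theorem divNatHom_apply (d n : ℕ) : divNatHom d n = (n : ℚ) / d := rfl

theorem divNatHom_le_iff (d : ℕ) [NeZero d] (a b : ℕ) :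
    divNatHom d a ≤ divNatHom d b ↔ a ≤ b := by
  have hd : (0 : ℚ) < d := by exact_mod_cast Nat.pos_of_neZero d
  rw [divNatHom_apply, divNatHom_apply, div_le_div_iff_of_pos_right hd, Nat.cast_le]

theorem divNatHom_injective (d : ℕ) [NeZero d] : Function.Injective (divNatHom d) := fun a b h =>
  le_antisymm ((divNatHom_le_iff d a b).1 h.le) ((divNatHom_le_iff d b a).1 h.ge)

/-- The substitution `s ↦ t ^ (1 / d)` from power series in `s` to Hahn series in `t`. -/
noncomputable def ramifyHahn (d : ℕ) [NeZero d] : R⟦X⟧ →+* HahnSeries ℚ R :=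
  (HahnSeries.embDomainRingHom (divNatHom d) (divNatHom_injective d) (divNatHom_le_iff d)).comp
    (HahnSeries.toPowerSeries.symm : R⟦X⟧ ≃+* HahnSeries ℕ R).toRingHom

theorem coeff_ramifyHahn (d : ℕ) [NeZero d] (f : R⟦X⟧) (n : ℕ) :
    (ramifyHahn d f).coeff ((n : ℚ) / d) = PowerSeries.coeff n f :=
  (HahnSeries.embDomain_coeff
    (f := ⟨⟨divNatHom d, divNatHom_injective d⟩, divNatHom_le_iff d _ _⟩) (a := n))

theorem exists_of_coeff_ramifyHahn_ne_zero {d : ℕ} [NeZero d] {f : R⟦X⟧} {q : ℚ}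
    (h : (ramifyHahn d f).coeff q ≠ 0) : ∃ n : ℕ, q = (n : ℚ) / d := by
  by_contra! hn
  refine h (HahnSeries.embDomain_of_notMem_range
    (f := ⟨⟨divNatHom d, divNatHom_injective d⟩, divNatHom_le_iff d _ _⟩) ?_)
  rintro ⟨n, rfl⟩
  exact hn n rfl

/-- The substitution `s ↦ t ^ (1 / d)` from power series in `s` to fractional power series in
`t`. -/
noncomputable def ramify (d : ℕ) [NeZero d] : R⟦X⟧ →+* FracPower R :=
  (ramifyHahn d).codRestrict (FracPower R) fun f => by
    refine ⟨⟨d, Nat.pos_of_neZero d, fun q hq => ?_⟩, fun q hq => ?_⟩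
    · obtain ⟨n, rfl⟩ := exists_of_coeff_ramifyHahn_ne_zero hq
      exact ⟨n, by simp⟩
    · by_contra h
      obtain ⟨n, rfl⟩ := exists_of_coeff_ramifyHahn_ne_zero h
      exact hq.not_ge (by positivity)

theorem coeff_ramify (d : ℕ) [NeZero d] (f : R⟦X⟧) (n : ℕ) :
    (ramify d f : HahnSeries ℚ R).coeff ((n : ℚ) / d) = PowerSeries.coeff n f :=
  coeff_ramifyHahn d f n

theorem ramify_injective (d : ℕ) [NeZero d] :
    Function.Injective (ramify d : R⟦X⟧ →+* FracPower R) := fun f g h => by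
  ext n
  rw [← coeff_ramify d, h, coeff_ramify]

theorem exists_ramify_eq {d : ℕ} [NeZero d] {x : FracPower R}
    (hx : ∀ q : ℚ, (x : HahnSeries ℚ R).coeff q ≠ 0 → ∃ n : ℤ, q = (n : ℚ) / (d : ℚ)) :
    ∃ f : R⟦X⟧, ramify d f = x := by
  have hd : (0 : ℚ) < d := by exact_mod_cast Nat.pos_of_neZero d
  refine ⟨PowerSeries.mk fun n => (x : HahnSeries ℚ R).coeff ((n : ℚ) / d), Subtype.ext ?_⟩
  ext q
  by_cases hq : ∃ n : ℕ, q = (n : ℚ) / d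
  · obtain ⟨n, rfl⟩ := hq
    rw [coeff_ramify, PowerSeries.coeff_mk]
  · have h1 : (ramify d (PowerSeries.mk fun n => (x : HahnSeries ℚ R).coeff ((n : ℚ) / d)) :
        HahnSeries ℚ R).coeff q = 0 := by
      by_contra h
      exact hq (exists_of_coeff_ramifyHahn_ne_zero h)
    rw [h1]
    by_contra h
    obtain ⟨n, rfl⟩ := hx q (Ne.symm h)
    have hn : 0 ≤ n := by
      by_contra! hn
      refine h (x.2.2 _ (div_neg_of_neg_of_pos (by exact_mod_cast hn) hd)).symm
    lift n to ℕ using hn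
    exact hq ⟨n, by simp⟩

/-- Allowing every multiple `e` of `d` makes it possible to write several series with one
denominator. -/
theorem exists_denominator_ramify (x : FracPower R) :
    ∃ d : ℕ, 0 < d ∧ ∀ e : ℕ, ∀ [NeZero e], d ∣ e →
      ∃ f : R⟦X⟧, ramify e f = x := by
  obtain ⟨d, hd, hx⟩ := x.2.1
  refine ⟨d, hd, ?_⟩
  rintro e _ ⟨k, rfl⟩
  refine exists_ramify_eq fun q hq => ?_
  obtain ⟨n, rfl⟩ := hx q hq
  have hk : (k : ℚ) ≠ 0 := by
    rintro h
    exact NeZero.ne (d * k) (by simp_all)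
  have hd' : (d : ℚ) ≠ 0 := by exact_mod_cast hd.ne'
  exact ⟨n * k, by push_cast; field_simp⟩

/-- The coefficients of a polynomial over `R^fr[[t]]` have a common denominator. -/
theorem exists_denominator_map_ramify (P : (FracPower R)[X]) :
    ∃ d : ℕ, 0 < d ∧ ∀ e : ℕ, ∀ [NeZero e], d ∣ e →
      ∃ P' : R⟦X⟧[X], P'.map (ramify e) = P := by
  choose d hd h using fun x : FracPower R => exists_denominator_ramify x
  refine ⟨∏ i ∈ P.support, d (P.coeff i), Finset.prod_pos fun i _ => hd _, fun e _ he => ?_⟩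
  refine (Polynomial.mem_map_rangeS (ramify e)).2 fun i => ?_
  by_cases hi : P.coeff i = 0
  · rw [hi]
    exact zero_mem _
  · exact h _ e ((Finset.dvd_prod_of_mem (fun i => d (P.coeff i))
      (Polynomial.mem_support_iff.2 hi)).trans he)

end Ramify

end FractionalSeries

/-! ### The Newton–Puiseux theorem -/

namespace FractionalSeries

open Polynomial PowerSeries

section AlgClosed

variable {L : Type*} [Field L]

/-- The monomial `t ^ r`. -/
noncomputable def tPow (L : Type*) [Field L] (r : ℚ) : FracLaurent L :=
  ⟨HahnSeries.single r 1, r.den, r.den_pos, fun q hq => ⟨r.num, by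
    rw [Rat.num_div_den]
    by_contra h
    exact hq (HahnSeries.coeff_single_of_ne h)⟩⟩

theorem coe_tPow_pow (r : ℚ) (n : ℕ) :
    ((tPow L r ^ n : FracLaurent L) : HahnSeries ℚ L) = HahnSeries.single (n * r) 1 := by
  rw [SubmonoidClass.coe_pow, tPow, HahnSeries.single_pow, one_pow, nsmul_eq_mul]

theorem tPow_ne_zero (r : ℚ) : tPow L r ≠ 0 := fun h =>
  HahnSeries.single_ne_zero (a := r) (one_ne_zero (α := L)) (congrArg Subtype.val h)

theorem coeff_mul_tPow_pow (x : FracLaurent L) (r q : ℚ) (n : ℕ) :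
    ((x * tPow L r ^ n : FracLaurent L) : HahnSeries ℚ L).coeff q =
      (x : HahnSeries ℚ L).coeff (q - n * r) := by
  rw [MulMemClass.coe_mul, coe_tPow_pow]
  nth_rw 1 [← sub_add_cancel q (n * r)]
  rw [HahnSeries.coeff_mul_single_add, mul_one]

/-- The inclusion `L^fr[[t]] ⊂ L^fr((t))`. -/
noncomputable def inclFracLaurent (L : Type*) [Field L] : FracPower L →+* FracLaurent L :=
  Subring.inclusion (fracPower_le_fracLaurent L)

theorem inclFracLaurent_injective : Function.Injective (inclFracLaurent L) :=
  Subring.inclusion_injective _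

/-- After rescaling the unknown by a power of `t`, a polynomial `P ≠ X ^ n` has integral
coefficients, one of the lower ones having a non-zero constant term. -/
theorem exists_scaleRoots_integral {P : (FracLaurent L)[X]} (hP : P.Monic)
    (hX : P ≠ Polynomial.X ^ P.natDegree) :
    ∃ s : FracLaurent L, s ≠ 0 ∧
      (∀ i, ∀ q < 0, ((P.scaleRoots s).coeff i : HahnSeries ℚ L).coeff q = 0) ∧
      ∃ i < P.natDegree, ((P.scaleRoots s).coeff i : HahnSeries ℚ L).coeff 0 ≠ 0 := by
  classical
  set n := P.natDegree with hn
  -- Newton polygon slopes. Scaling by `t^(-w j)` changes the order of the `i`-th coefficient to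
  -- `ord - (n - i) * w j`, which is non-negative for minimal `w j` and zero at `i = j`.
  let w : ℕ → ℚ := fun i => (P.coeff i : HahnSeries ℚ L).order / ((n - i : ℕ) : ℚ)
  have hne : ((Finset.range n).filter fun i => P.coeff i ≠ 0).Nonempty := by
    by_contra h
    rw [Finset.not_nonempty_iff_eq_empty, Finset.filter_eq_empty_iff] at h
    refine hX (Polynomial.ext fun i => ?_)
    rw [Polynomial.coeff_X_pow]
    rcases lt_trichotomy i n with hi | rfl | hi
    · rw [if_neg hi.ne]
      simpa using h (Finset.mem_range.2 hi)
    · rw [if_pos rfl]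
      exact hP.coeff_natDegree
    · rw [if_neg hi.ne', Polynomial.coeff_eq_zero_of_natDegree_lt hi]
  obtain ⟨j, hj, hmin⟩ := Finset.exists_min_image _ w hne
  rw [Finset.mem_filter, Finset.mem_range] at hj
  refine ⟨tPow L (-w j), tPow_ne_zero _, fun i q hq => ?_, j, hj.1, ?_⟩
  · rw [Polynomial.coeff_scaleRoots, coeff_mul_tPow_pow]
    rcases lt_trichotomy i n with hi | rfl | hi
    · by_cases hi0 : P.coeff i = 0
      · rw [hi0]; rfl
      · have h1 := hmin i (by simp [hi, hi0])
        have hpos : (0 : ℚ) < ((n - i : ℕ) : ℚ) := by exact_mod_cast Nat.sub_pos_of_lt hi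
        rw [le_div_iff₀ hpos] at h1
        exact HahnSeries.coeff_eq_zero_of_lt_order (by rw [← hn]; linarith)
    · rw [hP.coeff_natDegree]
      simp [HahnSeries.coeff_one, hq.ne, ← hn]
    · rw [Polynomial.coeff_eq_zero_of_natDegree_lt hi]; rfl
  · rw [Polynomial.coeff_scaleRoots, coeff_mul_tPow_pow, ← hn]
    have hpos : ((n - j : ℕ) : ℚ) ≠ 0 := by exact_mod_cast (Nat.sub_pos_of_lt hj.1).ne'
    have : (0 : ℚ) - ((n - j : ℕ) : ℚ) * -w j = (P.coeff j : HahnSeries ℚ L).order := by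
      simp only [w]
      field_simp
      ring
    rw [this, Ne, HahnSeries.coeff_order_eq_zero]
    exact fun h => hj.2 (Subtype.ext h)

/-- A polynomial over `L^fr((t))` with integral coefficients comes from `L⟦X⟧[X]`. -/
theorem exists_map_ramify_eq {Q : (FracLaurent L)[X]}
    (hQ : ∀ i, ∀ q < 0, (Q.coeff i : HahnSeries ℚ L).coeff q = 0) :
    ∃ (d : ℕ) (_ : NeZero d) (P : L⟦X⟧[X]), P.map ((inclFracLaurent L).comp (ramify d)) = Q := by
  obtain ⟨Q', rfl⟩ := (Polynomial.mem_map_range (inclFracLaurent L) (p := Q)).2 fun i =>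
    ⟨⟨(Q.coeff i).1, (Q.coeff i).2, hQ i⟩, rfl⟩
  obtain ⟨d, hd, h⟩ := exists_denominator_map_ramify Q'
  have : NeZero d := ⟨hd.ne'⟩
  obtain ⟨P, hP⟩ := h d dvd_rfl
  exact ⟨d, this, P, by rw [← Polynomial.map_map, hP]; rfl⟩

variable [CharZero L] [IsAlgClosed L]

/-- A monic polynomial of degree at least `2` with vanishing second coefficient, other than `X ^ n`,
has, after rescaling the unknown, a monic factor of intermediate degree. -/
theorem exists_monic_factor_scaleRoots {P : (FracLaurent L)[X]} (hP : P.Monic)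
    (hdeg : 2 ≤ P.natDegree) (hnext : P.coeff (P.natDegree - 1) = 0)
    (hX : P ≠ Polynomial.X ^ P.natDegree) :
    ∃ (s : FracLaurent L) (G : (FracLaurent L)[X]), s ≠ 0 ∧ G.Monic ∧ 0 < G.natDegree ∧
      G.natDegree < P.natDegree ∧ G ∣ P.scaleRoots s := by
  obtain ⟨s, hs, hint, i, hi, hi0⟩ := exists_scaleRoots_integral hP hX
  obtain ⟨d, _, Q, hQ⟩ := exists_map_ramify_eq hint
  have hinj : Function.Injective ((inclFracLaurent L).comp (ramify d)) :=
    inclFracLaurent_injective.comp (ramify_injective d)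
  have hcoeff (k : ℕ) : PowerSeries.constantCoeff (Q.coeff k) =
      ((P.scaleRoots s).coeff k : HahnSeries ℚ L).coeff 0 := by
    rw [← hQ, Polynomial.coeff_map, ← PowerSeries.coeff_zero_eq_constantCoeff_apply,
      ← coeff_ramify d, Nat.cast_zero, zero_div]
    rfl
  have hQm : Q.Monic := by
    refine Polynomial.monic_of_injective hinj ?_
    rw [hQ]
    exact (Polynomial.monic_scaleRoots_iff s).2 hP
  have hQd : Q.natDegree = P.natDegree := by
    rw [← Polynomial.natDegree_map_eq_of_injective hinj, hQ, Polynomial.natDegree_scaleRoots]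
  have hRd : (Q.map (PowerSeries.constantCoeff (R := L))).natDegree = P.natDegree := by
    rw [hQm.natDegree_map, hQd]
  obtain ⟨a, ha⟩ := IsAlgClosed.exists_root (Q.map (PowerSeries.constantCoeff (R := L)))
    (fun h => by
      rw [Polynomial.degree_eq_natDegree (hQm.map _).ne_zero, hRd] at h
      norm_cast at h
      omega)
  -- If the reduction were `(X - a)^n`, its vanishing second coefficient `-n a` would force `a = 0`
  -- in characteristic zero, and `X^n` contradicts the non-zero constant term at index `i`.
  obtain ⟨G, hG, h1, h2, h3⟩ := PowerSeries.exists_monic_factor hQm ha (fun h => by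
    rw [hQd] at h
    have h' := congrArg Polynomial.nextCoeff h
    rw [(Polynomial.monic_X_sub_C a).nextCoeff_pow, Polynomial.nextCoeff_X_sub_C,
      Polynomial.nextCoeff_of_natDegree_pos (by omega), hRd, Polynomial.coeff_map, hcoeff,
      Polynomial.coeff_scaleRoots, hnext, zero_mul] at h'
    have ha0 : a = 0 := by
      have h'' : (0 : L) = P.natDegree • -a := h'
      have hn : (P.natDegree : L) ≠ 0 := by
        exact_mod_cast (by omega : P.natDegree ≠ 0)
      simpa [hn] using h''
    rw [ha0, Polynomial.C_0, sub_zero] at h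
    have := congrArg (fun p : L[X] => p.coeff i) h
    simp only [Polynomial.coeff_map, hcoeff, Polynomial.coeff_X_pow, if_neg hi.ne] at this
    exact hi0 this)
  refine ⟨s, G.map ((inclFracLaurent L).comp (ramify d)), hs, hG.map _, ?_, ?_, ?_⟩
  · rwa [hG.natDegree_map]
  · rwa [hG.natDegree_map, ← hQd]
  · rw [← hQ]
    exact Polynomial.map_dvd _ h3

/-- **Newton–Puiseux theorem**, for monic polynomials. -/
theorem exists_root_of_monic (n : ℕ) (P : (FracLaurent L)[X]) (hP : P.Monic)
    (hn : P.natDegree = n) (hpos : 0 < n) : ∃ x, P.eval x = 0 := by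
  induction n using Nat.strong_induction_on generalizing P with
  | _ n ih =>
    have hchar : ((n : ℕ) : FracLaurent L) ≠ 0 := by
      intro h
      have := congrArg (fun x : FracLaurent L => (x : HahnSeries ℚ L).coeff 0) h
      have h2 : ((n : FracLaurent L) : HahnSeries ℚ L) = HahnSeries.C (n : L) := by simp
      rw [h2, HahnSeries.C_apply, HahnSeries.coeff_single_same] at this
      exact hpos.ne' (Nat.cast_eq_zero.1 this)
    obtain rfl | hn2 : n = 1 ∨ 2 ≤ n := by omega
    · exact Polynomial.exists_root_of_degree_eq_one
        (by rw [Polynomial.degree_eq_natDegree hP.ne_zero, hn]; rfl)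
    -- Tschirnhaus translation: the second coefficient of `T` is `P.nextCoeff + n * c = 0`.
    set c : FracLaurent L := -P.nextCoeff / n with hc
    set T := Polynomial.taylor c P with hT
    have hTm : T.Monic := (Polynomial.leadingCoeff_taylor _ _).trans hP
    have hTd : T.natDegree = n := by rw [hT, Polynomial.natDegree_taylor, hn]
    have hroot : ∀ x, T.eval x = 0 → ∃ x, P.eval x = 0 := fun x hx =>
      ⟨x + c, by simpa [hT, Polynomial.taylor_eval] using hx⟩
    have hnext : T.coeff (T.natDegree - 1) = 0 := by
      rw [hTd, hT, Polynomial.coeff_taylor_natDegree_sub_one hP hn hpos, hc,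
        Polynomial.nextCoeff_of_natDegree_pos (hn ▸ hpos), hn]
      field_simp
      ring
    by_cases hX : T = Polynomial.X ^ T.natDegree
    · refine hroot 0 ?_
      rw [hX, hTd]
      simp [hpos.ne']
    obtain ⟨s, G, hs, hG, h1, h2, h3⟩ :=
      exists_monic_factor_scaleRoots hTm (hTd ▸ hn2) hnext hX
    obtain ⟨x, hx⟩ := ih G.natDegree (hTd ▸ h2) G hG rfl h1
    have hx' := Polynomial.eval_eq_zero_of_dvd_of_eval_eq_zero h3 hx
    -- Roots of `T.scaleRoots s` are `s` times roots of `T`.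
    refine hroot (x / s) ?_
    have := Polynomial.scaleRoots_eval_mul T (x / s) s
    rw [mul_div_cancel₀ _ hs, hx'] at this
    exact (mul_eq_zero.1 this.symm).resolve_left (pow_ne_zero _ hs)

/-- **Newton–Puiseux theorem**: the field of Puiseux series over an algebraically closed field of
characteristic zero is algebraically closed. -/
instance isAlgClosed_fracLaurent : IsAlgClosed (FracLaurent L) :=
  IsAlgClosed.of_exists_root _ fun P hP hirr =>
    exists_root_of_monic _ P hP rfl hirr.natDegree_pos

end AlgClosed

end FractionalSeries

/-! ### Square roots and parity of multiplicities -/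

namespace FractionalSeries

open Polynomial PowerSeries

/-- Exchanging the two variables of an iterated power series. -/
noncomputable def swapVariables (R : Type*) [CommRing R] : R⟦X⟧⟦X⟧ →+* R⟦X⟧⟦X⟧ where
  toFun f := PowerSeries.mk fun n => PowerSeries.mk fun m =>
    PowerSeries.coeff n (PowerSeries.coeff m f)
  map_one' := by
    ext n m
    by_cases hn : n = 0 <;> by_cases hm : m = 0 <;> simp [PowerSeries.coeff_one, hn, hm]
  map_mul' f g := by
    ext n m
    simp only [PowerSeries.coeff_mk, PowerSeries.coeff_mul, map_sum]
    exact Finset.sum_comm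
  map_zero' := by ext; simp
  map_add' f g := by ext; simp

theorem coeff_coeff_swapVariables {R : Type*} [CommRing R] (f : R⟦X⟧⟦X⟧) (n m : ℕ) :
    PowerSeries.coeff m (PowerSeries.coeff n (swapVariables R f)) =
      PowerSeries.coeff n (PowerSeries.coeff m f) := by
  simp [swapVariables]

section SquareRoot

variable {L : Type*} [Field L]

/-- If a polynomial over `L^fr[[t]]` has a square root in `L[[u]]^fr[[t]]`, then its roots that
vanish at `t = 0` have even multiplicity. -/
theorem even_rootMultiplicity_of_sq {P : (FracPower L)[X]} (hP : P ≠ 0) {δ : FracPower L⟦X⟧}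
    (hδ : δ ^ 2 = toPowerSeriesSeries L P) {U : FracPower L}
    (hU : (U : HahnSeries ℚ L).coeff 0 = 0) : Even (P.rootMultiplicity U) := by
  obtain ⟨d₁, hd₁, h₁⟩ := exists_denominator_map_ramify P
  obtain ⟨d₂, hd₂, h₂⟩ := exists_denominator_ramify δ
  obtain ⟨d₃, hd₃, h₃⟩ := exists_denominator_ramify U
  have : NeZero (d₁ * d₂ * d₃) := ⟨(by positivity : 0 < d₁ * d₂ * d₃).ne'⟩
  obtain ⟨P, rfl⟩ := h₁ (d₁ * d₂ * d₃) ⟨d₂ * d₃, mul_assoc _ _ _⟩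
  obtain ⟨δ, rfl⟩ := h₂ (d₁ * d₂ * d₃) ⟨d₁ * d₃, by ring⟩
  obtain ⟨U, rfl⟩ := h₃ (d₁ * d₂ * d₃) (dvd_mul_left _ _)
  generalize d₁ * d₂ * d₃ = d at *
  rw [← Polynomial.eq_rootMultiplicity_map (ramify_injective d)]
  -- Here `δ` is a series in `s` over `L⟦u⟧`, whereas `P` is a polynomial in `u` over `L⟦s⟧`; the
  -- swap puts both in `L⟦s⟧⟦u⟧`.
  refine PowerSeries.even_rootMultiplicity (δ := swapVariables L δ)
    (fun h => hP (by rw [h, Polynomial.map_zero])) ?_ ?_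
  · rw [← map_pow]
    ext n m
    rw [coeff_coeff_swapVariables, ← coeff_ramify d (δ ^ 2), map_pow (ramify d) δ 2, hδ,
      coeff_toPowerSeriesSeries, Polynomial.coeff_map, coeff_ramify, Polynomial.coeff_coe]
  · rw [← PowerSeries.coeff_zero_eq_constantCoeff_apply, ← coeff_ramify d]
    simpa using hU

/-- Allows a square root to be translated together with `P`. The substitution `u ↦ u + c` makes
sense for coefficients in `L[u]`, but for `c ≠ 0` not in `L⟦u⟧`. -/
theorem map_taylor_toPolySeries (c : L) (P : (FracPower L)[X]) :
    FracPower.map (Polynomial.taylorAlgHom c : L[X] →ₐ[L] L[X]).toRingHom (toPolySeries L P) =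
      toPolySeries L (Polynomial.taylor (FracPower.const c) P) := by
  have h : (FracPower.map (Polynomial.taylorAlgHom c : L[X] →ₐ[L] L[X]).toRingHom).comp
      (toPolySeries L) =
      (toPolySeries L).comp (Polynomial.taylorAlgHom (FracPower.const c)).toRingHom := by
    refine Polynomial.ringHom_ext (fun a => Subtype.ext ?_) (Subtype.ext ?_)
    · ext q : 2
      simp [toPolySeries, FracPower.map]
    · ext q : 2
      by_cases hq : q = 0 <;>
        simp [toPolySeries, FracPower.map, FracPower.const, HahnSeries.coeff_single_of_ne, hq]
  exact congrArg (fun f => f P) h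

/-- Both sides are the multiplicity of `0` in `P` translated by `x`. -/
theorem rootMultiplicity_taylor {R : Type*} [CommRing R] (P : R[X]) (c x : R) :
    (Polynomial.taylor c P).rootMultiplicity (x - c) = P.rootMultiplicity x := by
  rw [Polynomial.rootMultiplicity_eq_rootMultiplicity, ← Polynomial.taylor_apply,
    Polynomial.taylor_taylor, P.rootMultiplicity_eq_rootMultiplicity, ← Polynomial.taylor_apply,
    sub_add_cancel]

/-- If a polynomial over `L^fr[[t]]` has a square root in `L[u]^fr[[t]]`, then its roots that
are finite at `t = 0` have even multiplicity. -/
theorem even_rootMultiplicity_of_sq_polynomial {P : (FracPower L)[X]} (hP : P ≠ 0)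
    {δ : FracPower L[X]} (hδ : δ ^ 2 = toPolySeries L P) (U : FracPower L) :
    Even (P.rootMultiplicity U) := by
  set c := (U : HahnSeries ℚ L).coeff 0 with hc
  rw [← rootMultiplicity_taylor P (FracPower.const c) U]
  refine even_rootMultiplicity_of_sq (fun h => hP ((Polynomial.taylor_eq_zero _ _).1 h))
    (δ := FracPower.map Polynomial.coeToPowerSeries.ringHom
      (FracPower.map (Polynomial.taylorAlgHom c : L[X] →ₐ[L] L[X]).toRingHom δ)) ?_ ?_
  · rw [← map_pow, ← map_pow, hδ, map_taylor_toPolySeries]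
    rfl
  · simp [FracPower.const, ← hc]

end SquareRoot

/-! ### Base change to the algebraic closure and conclusion -/

section BaseChange

variable {R S : Type*} [CommRing R] [CommRing S]

theorem coeff_fracPower_map (f : R →+* S) (x : FracPower R) (q : ℚ) :
    (FracPower.map f x : HahnSeries ℚ S).coeff q = f ((x : HahnSeries ℚ R).coeff q) := rfl

theorem map_toPolySeries (f : R →+* S) (P : (FracPower R)[X]) :
    FracPower.map (Polynomial.mapRingHom f) (toPolySeries R P) =
      toPolySeries S (P.map (FracPower.map f)) := by
  refine Subtype.ext (HahnSeries.ext (funext fun q => Polynomial.ext fun n => ?_))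
  rw [coeff_fracPower_map, coeff_toPolySeries, Polynomial.coe_mapRingHom, Polynomial.coeff_map,
    coeff_toPolySeries, Polynomial.coeff_map, coeff_fracPower_map]

theorem map_toPowerSeriesSeries (f : R →+* S) (P : (FracPower R)[X]) :
    FracPower.map (PowerSeries.map f) (toPowerSeriesSeries R P) =
      toPowerSeriesSeries S (P.map (FracPower.map f)) := by
  refine Subtype.ext (HahnSeries.ext (funext fun q => PowerSeries.ext fun n => ?_))
  rw [coeff_fracPower_map, coeff_toPowerSeriesSeries, PowerSeries.coeff_map,
    coeff_toPowerSeriesSeries, Polynomial.coeff_map, coeff_fracPower_map]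

theorem fracPower_map_injective {f : R →+* S} (hf : Function.Injective f) :
    Function.Injective (FracPower.map f) := fun x y h =>
  Subtype.ext (HahnSeries.ext (funext fun q => hf (by
    rw [← coeff_fracPower_map, h, coeff_fracPower_map])))

end BaseChange

end FractionalSeries

theorem mainTheorem12 {K : Type*} [Field K] [CharZero K]
    {Kbar : Type*} [Field Kbar] [Algebra K Kbar] [IsAlgClosure K Kbar]
    (Δ : Polynomial (FracPower K)) (hΔ : Δ ≠ 0) :
    (Δ.map (toFracLaurent K Kbar)).Splits ∧
    ((∃ δ : FracPower (PowerSeries K), δ ^ 2 = toPowerSeriesSeries K Δ) →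
      ∀ U : FracLaurent Kbar, (Δ.map (toFracLaurent K Kbar)).IsRoot U → VanishesAtZero U →
        Even ((Δ.map (toFracLaurent K Kbar)).rootMultiplicity U)) ∧
    ((∃ δ : FracPower (Polynomial K), δ ^ 2 = toPolySeries K Δ) →
      ∀ U : FracLaurent Kbar, (Δ.map (toFracLaurent K Kbar)).IsRoot U → FiniteAtZero U →
        Even ((Δ.map (toFracLaurent K Kbar)).rootMultiplicity U)) := by
  have : CharZero Kbar := charZero_of_injective_algebraMap (algebraMap K Kbar).injective
  have : IsAlgClosed Kbar := IsAlgClosure.isAlgClosed K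
  set ΔL : Polynomial (FracPower Kbar) := Δ.map (FracPower.map (algebraMap K Kbar)) with hΔL
  have hmap : Δ.map (toFracLaurent K Kbar) = ΔL.map (inclFracLaurent Kbar) := by
    rw [hΔL, Polynomial.map_map]
    rfl
  have hΔL0 : ΔL ≠ 0 := (Polynomial.map_ne_zero_iff
    (fracPower_map_injective (algebraMap K Kbar).injective)).2 hΔ
  -- A root that is finite at `t = 0` lies in `FracPower Kbar`, so its multiplicity can be computed
  -- there.
  have hmult (U : FracPower Kbar) : (ΔL.map (inclFracLaurent Kbar)).rootMultiplicity
      (inclFracLaurent Kbar U) = ΔL.rootMultiplicity U :=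
    (Polynomial.eq_rootMultiplicity_map inclFracLaurent_injective U).symm
  rw [hmap]
  refine ⟨IsAlgClosed.splits _, ?_, ?_⟩
  · rintro ⟨δ, hδ⟩ U - hU
    have h := even_rootMultiplicity_of_sq hΔL0
      (δ := FracPower.map (PowerSeries.map (algebraMap K Kbar)) δ)
      (by rw [← map_pow, hδ, map_toPowerSeriesSeries])
      (U := ⟨U, U.2, fun q hq => hU q hq.le⟩) (hU 0 le_rfl)
    rwa [← hmult] at h
  · rintro ⟨δ, hδ⟩ U - hU
    have h := even_rootMultiplicity_of_sq_polynomial hΔL0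
      (δ := FracPower.map (Polynomial.mapRingHom (algebraMap K Kbar)) δ)
      (by rw [← map_pow, hδ, map_toPolySeries]) ⟨U, U.2, hU⟩
    rwa [← hmult] at h
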